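/- **Setting.** Let $S$ be a set of unit squares of the $\mathbb Z^2$ lattice in $\mathbb R^2$ and let $G$ be the subcomplex they define; its vertices and edges are the corners and sides of the squares in $S$. Assume that the union of the closed squares in $S$ is simply connected. A vertex is *interior* if all four squares around it belong to $S$. A *ring* is a pair of concentric circles in $\mathbb R^2=\mathbb C$: an inner circle $c$ of signed radius $r$ (positive: counter-clockwise, negative: clockwise, zero: a point) and an outer circle $C$ of radius $R>|r|$. An *orthogonal ring pattern* on $G$ assigns a ring to every vertex of $G$ so that: 1. for neighboring vertices $i,j$ of $G$ the circles $C_i$ and $c_j$ intersect orthogonally, and so do $c_i$ and $C_j$ (a circle of radius zero intersects orthogonally every circle through it); 2. in every square of $G$ with lower left corner $(m,n)$, the circles $c_{m,n}$, $c_{m+1,n+1}$, $C_{m+1,n}$, $C_{m,n+1}$ pass through one point $t$, and $C_{m+1,n}$, $C_{m,n+1}$ touch there with their centers on opposite sides; 3. the points $c_{m,n}\cap C_{m+1,n}\setminus C_{m,n+1}$, $t$, $c_{m,n}\cap C_{m,n+1}\setminus C_{m+1,n}$ exist and are in counter-clockwise order on $c_{m,n}$ if $r_{m,n}>0$, and in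 clockwise order if $r_{m,n}<0$; likewise the points $c_{m+1,n+1}\cap C_{m,n+1}\setminus C_{m+1,n}$, $t$, $c_{m+1,n+1}\cap C_{m+1,n}\setminus C_{m,n+1}$ exist and have on $c_{m+1,n+1}$ the orientation given by the sign of $r_{m+1,n+1}$ if that is nonzero. **Theorem.** (a) For every orthogonal ring pattern on $G$ there are $\ell_0>0$ and real numbers $\rho_i$ (the *$\rho$-radii*) with $R_i=\ell_0\cosh\rho_i$ and $r_i=\ell_0\sinh\rho_i$ at all vertices $i$, and for every such $\ell_0,\rho$ and every interior vertex $i$ $$2\pi=\sum_{j\sim i}2\arctan\bigl(e^{\rho_i-\rho_j}\bigr),$$ the sum being over the four neighbors $j$ of $i$. (b) Conversely, let $\rho$ be any real function on the vertices of $G$ satisfying this equation at every interior vertex (some $\rho_i$ may be zero), and let $\ell_0>0$. Then there exists an orthogonal ring pattern on $G$ with $R_i=\ell_0\cosh\rho_i$, $r_i=\ell_0\sinh\rho_i$. If moreover any two squares in $S$ are joined by a chain of squares in $S$ in which consecutive squares share a side (so that $G$ is not pinched at a vertex), this pattern is unique up to a rotation and a translation of the plane. -/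

import Mathlib

/-- The square lattice `ℤ²` as a graph. It is used both for lattice points and for unit squares
(a unit square is named by its lower left corner, and squares with a common side are adjacent). -/
def latticeGraph : SimpleGraph (ℤ × ℤ) where
  Adj v w := (v.2 = w.2 ∧ |v.1 - w.1| = 1) ∨ (v.1 = w.1 ∧ |v.2 - w.2| = 1)
  symm := ⟨fun v w h => by
    rcases h with ⟨h1, h2⟩ | ⟨h1, h2⟩
    · exact Or.inl ⟨h1.symm, by rw [abs_sub_comm]; exact h2⟩
    · exact Or.inr ⟨h1.symm, by rw [abs_sub_comm]; exact h2⟩⟩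
  loopless := ⟨fun v h => by simp at h⟩

/-- The four corners of the unit square with lower left corner `p`. -/
def squareCorners (p : ℤ × ℤ) : Set (ℤ × ℤ) :=
  {p, (p.1 + 1, p.2), (p.1 + 1, p.2 + 1), (p.1, p.2 + 1)}

/-- The vertices of the subcomplex of the `ℤ²` lattice that is defined by a set `S` of squares. -/
def vertexSet (S : Set (ℤ × ℤ)) : Set (ℤ × ℤ) :=
  {v | ∃ p ∈ S, v ∈ squareCorners p}

/-- `v` and `w` are neighbors in the subcomplex: they are the endpoints of a side of one of
its squares. -/
def IsEdge (S : Set (ℤ × ℤ)) (v w : ℤ × ℤ) : Prop :=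
  latticeGraph.Adj v w ∧ ∃ p ∈ S, v ∈ squareCorners p ∧ w ∈ squareCorners p

/-- The underlying space of the subcomplex: the union of its closed unit squares. -/
def carrier (S : Set (ℤ × ℤ)) : Set (ℝ × ℝ) :=
  ⋃ p ∈ S, Set.Icc (p.1 : ℝ) (p.1 + 1) ×ˢ Set.Icc (p.2 : ℝ) (p.2 + 1)

/-- `v` is an interior vertex: all four squares around it belong to the subcomplex. -/
def IsInteriorVertex (S : Set (ℤ × ℤ)) (v : ℤ × ℤ) : Prop :=
  (v.1, v.2) ∈ S ∧ (v.1 - 1, v.2) ∈ S ∧ (v.1 - 1, v.2 - 1) ∈ S ∧ (v.1, v.2 - 1) ∈ S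

/-- The four lattice neighbors of `v`. -/
def latticeNeighbors (v : ℤ × ℤ) : Finset (ℤ × ℤ) :=
  {(v.1 + 1, v.2), (v.1, v.2 + 1), (v.1 - 1, v.2), (v.1, v.2 - 1)}

/-- A ring: two concentric circles in the plane `ℝ² = ℂ`. The inner radius carries a sign (positive:
counter-clockwise, negative: clockwise), the outer radius is positive. An inner circle of radius
zero is a point. -/
structure OrientedRing where
  center : ℂ
  inner : ℝ
  outer : ℝ
  abs_inner_lt_outer : |inner| < outer

/-- The inner circle of a ring. -/
def OrientedRing.innerCircle (A : OrientedRing) : Set ℂ := Metric.sphere A.center |A.inner|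

/-- The outer circle of a ring. -/
def OrientedRing.outerCircle (A : OrientedRing) : Set ℂ := Metric.sphere A.center A.outer

/-- The outer circle of `A` and the inner circle of `B` intersect orthogonally: they have a common
point at which their radii are perpendicular. -/
def OuterInnerOrthogonal (A B : OrientedRing) : Prop :=
  ∃ x ∈ A.outerCircle ∩ B.innerCircle, inner ℝ (x - A.center) (x - B.center) = 0

/-- Two rings intersect orthogonally. -/
def RingsOrthogonal (A B : OrientedRing) : Prop :=
  OuterInnerOrthogonal A B ∧ OuterInnerOrthogonal B A

/-- The triangle `x, y, z` is positively oriented. For three points of a circle: they are in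
counter-clockwise order on the circle. -/
def IsCCW (x y z : ℂ) : Prop :=
  0 < (starRingEnd ℂ (y - x) * (z - x)).im

/-- Orientation rule at a ring `A` whose neighbors in a square are `B` and `D` (in the
counter-clockwise order of the lattice), where `t` is the point common to the inner circle of `A`
and the outer circles of `B` and `D`: the second intersection point of `A` with `B`, the point `t`,
and the second intersection point of `A` with `D` are in counter-clockwise order on the
inner circle of `A` if its radius is positive, and in clockwise order if it is negative.
An inner circle of radius zero has no orientation. -/
def CornerOriented (A B D : OrientedRing) (t : ℂ) : Prop :=
  (0 < A.inner →
    ∃ x ∈ (A.innerCircle ∩ B.outerCircle) \ D.outerCircle,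
    ∃ y ∈ (A.innerCircle ∩ D.outerCircle) \ B.outerCircle, IsCCW x t y) ∧
  (A.inner < 0 →
    ∃ x ∈ (A.innerCircle ∩ B.outerCircle) \ D.outerCircle,
    ∃ y ∈ (A.innerCircle ∩ D.outerCircle) \ B.outerCircle, IsCCW y t x)

/-- The condition on the rings `A, B, C, D` at the corners `(m,n), (m+1,n), (m+1,n+1), (m,n+1)`
of a square: the inner circles of `A, C` and the outer circles of `B, D` pass through one point,
where the outer circles (which are always positively oriented) touch with their centers on
opposite sides, and the orientation rule holds at `A` and at `C`. For `A.inner` or `C.inner`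
different from zero, orthogonality already implies that the outer circles have a common tangent;
if both vanish it has to be asked for. -/
def SquareCondition (A B C D : OrientedRing) : Prop :=
  ∃ t : ℂ, t ∈ A.innerCircle ∧ t ∈ C.innerCircle ∧ t ∈ B.outerCircle ∧ t ∈ D.outerCircle ∧
    Sbtw ℝ B.center t D.center ∧ CornerOriented A B D t ∧ CornerOriented C D B t

/-- `P` assigns rings to the vertices of the subcomplex defined by the squares in `S` such that
they form an orthogonal ring pattern. (Values of `P` at other lattice points are irrelevant.) -/
structure IsOrthogonalRingPattern (S : Set (ℤ × ℤ)) (P : ℤ × ℤ → OrientedRing) : Prop where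
  orthogonal : ∀ v w, IsEdge S v w → RingsOrthogonal (P v) (P w)
  square : ∀ m n : ℤ, (m, n) ∈ S →
    SquareCondition (P (m, n)) (P (m + 1, n)) (P (m + 1, n + 1)) (P (m, n + 1))

/-- The rings at the vertices have the radii `R = ℓ cosh ρ` and `r = ℓ sinh ρ`. -/
def HasRhoRadii (S : Set (ℤ × ℤ)) (P : ℤ × ℤ → OrientedRing) (ℓ : ℝ) (ρ : ℤ × ℤ → ℝ) : Prop :=
  ∀ v ∈ vertexSet S, (P v).outer = ℓ * Real.cosh (ρ v) ∧ (P v).inner = ℓ * Real.sinh (ρ v)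

/-- The closure equation at all interior vertices. -/
def ClosureEquation (S : Set (ℤ × ℤ)) (ρ : ℤ × ℤ → ℝ) : Prop :=
  ∀ v, IsInteriorVertex S v →
    2 * Real.pi = ∑ w ∈ latticeNeighbors v, 2 * Real.arctan (Real.exp (ρ v - ρ w))

/-! Orthogonality and the orientation rule fix a square A, B, C, D of rings up to a rigid motion: if
t is the touching point and w the unit vector from t towards the center of B, then the centers are t
- i w r_A, t + w R_B, t + i w r_C, t - w R_D (`IsSquareFrame`). So a pattern amounts to one frame
(t, w) per square, such that different squares give the same center at a common corner. Pythagoras,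
applied in both orders along an edge, shows that R² - r² is constant; this constant is ℓ².

Let two squares share a side with ends i, j. Comparing the vector between the two centers in both
frames gives w' = exp(± i g(ρ_i - ρ_j)) w, where g is the Gudermannian `frameAngle`
(`exp_frameAngle_sub_mul`). Around an interior vertex the four rotations compose to the identity, so
the four angles add up to a multiple of 2π; each is smaller than π/2 in absolute value, so the sum
is 0, which is the closure equation.

Conversely, the closure equation says that directions w can be chosen consistently around each
vertex. Simple connectivity turns such local data into global data (`exists_potential`); this is
used twice, for the angles of the frames and then for the centers. Uniqueness holds because ρ alone
determines the rotation between neighboring frames, so one frame determines all others reached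
across sides. -/

/-! ### Cocycles on simply connected spaces -/

/-- An additive cocycle that is constant on the overlaps of a cover of a simply connected space by
preconnected open sets is a coboundary. -/
theorem exists_coboundary_of_simplyConnected {X ι M : Type*} [TopologicalSpace X]
    [SimplyConnectedSpace X] [LocallyPathConnectedSpace X] [AddCommGroup M]
    (U : ι → Set X) (hUo : ∀ i, IsOpen (U i)) (hUc : ∀ i, IsPreconnected (U i))
    (hcov : ∀ x, ∃ i, x ∈ U i) (c : ι → ι → M)
    (hc : ∀ i j k x, x ∈ U i → x ∈ U j → x ∈ U k → c i j + c j k = c i k) :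
    ∃ F : ι → M, ∀ i j, (U i ∩ U j).Nonempty → F j - F i = c i j := by
  classical
  let _ : TopologicalSpace M := ⊥
  have _ : DiscreteTopology M := ⟨rfl⟩
  choose idx hidx using hcov
  have hself : ∀ i x, x ∈ U i → c i i = 0 := fun i x hx => by
    simpa using hc i i i x hx hx hx
  -- The cocycle glues the pieces `U i × M`, with `M` discrete, by translations into a covering
  -- space. A global section is a family of locally constant functions `f i` with differences `c i
  -- j`.
  let Z : FiberBundleCore ι X M :=
    { baseSet := U
      isOpen_baseSet := hUo
      indexAt := idx
      mem_baseSet_at := hidx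
      coordChange := fun i j _ m => m + c i j
      coordChange_self := fun i x hx m => by rw [hself i x hx, add_zero]
      continuousOn_coordChange := fun i j =>
        ((continuous_of_discreteTopology (f := fun m : M => m + c i j)).comp
          continuous_snd).continuousOn
      coordChange_comp := fun i j k x hx m => by
        rw [add_assoc, hc i j k x hx.1.1 hx.1.2 hx.2] }
  have hcover : IsCoveringMap (Bundle.TotalSpace.proj : Bundle.TotalSpace M Z.Fiber → X) :=
    FiberBundle.isCoveringMap
  obtain ⟨x₀⟩ : Nonempty X := inferInstance
  -- The section is a lift of the identity, which exists by simple and local path connectedness.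
  obtain ⟨s, ⟨-, hs⟩, -⟩ := hcover.existsUnique_continuousMap_lifts (ContinuousMap.id X) x₀
    (⟨x₀, (0 : M)⟩ : Bundle.TotalSpace M Z.Fiber) rfl
  have hs' : ∀ x, (s x).1 = x := fun x => congrFun hs x
  let f : ι → X → M := fun i x => (Z.localTriv i (s x)).2
  have hf : ∀ i, ContinuousOn (f i) (U i) := fun i => by
    refine continuous_snd.comp_continuousOn
      ((Z.localTriv i).continuousOn_toFun.comp s.continuous.continuousOn fun x hx => ?_)
    rw [(Z.localTriv i).source_eq]
    change (s x).1 ∈ U i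
    rwa [hs' x]
  have hfc : ∀ i j x, x ∈ U i → x ∈ U j → f j x - f i x = c i j := fun i j x hi hj => by
    let m : M := (s x).2
    have h : ∀ k, f k x = m + c (idx x) k := fun k => by
      change m + c (idx (s x).1) k = _
      rw [hs' x]
    rw [h, h, ← hc (idx x) i j x (hidx x) hi hj]
    abel
  refine ⟨fun i => if h : (U i).Nonempty then f i h.some else 0, fun i j hij => ?_⟩
  obtain ⟨x, hi, hj⟩ := hij
  have hval : ∀ k, x ∈ U k → (if h : (U k).Nonempty then f k h.some else 0) = f k x :=
    fun k hk => by
      rw [dif_pos ⟨x, hk⟩]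
      exact (hUc k).constant (hf k) (Set.Nonempty.some_mem ⟨x, hk⟩) hk
  beta_reduce
  rw [hval i hi, hval j hj, hfc i j x hi hj]

/-! ### Local topology of a union of lattice squares -/

theorem mem_squareCorners {p v : ℤ × ℤ} :
    v ∈ squareCorners p ↔ (p.1 ≤ v.1 ∧ v.1 ≤ p.1 + 1) ∧ p.2 ≤ v.2 ∧ v.2 ≤ p.2 + 1 := by
  simp only [squareCorners, Set.mem_insert_iff, Set.mem_singleton_iff, Prod.ext_iff]
  lia

theorem mem_vertexSet {S : Set (ℤ × ℤ)} {p v : ℤ × ℤ} (hp : p ∈ S) (hv : v ∈ squareCorners p) :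
    v ∈ vertexSet S := ⟨p, hp, hv⟩

/-- The closed unit square with lower left corner `p`. -/
def closedSquare (p : ℤ × ℤ) : Set (ℝ × ℝ) :=
  Set.Icc (p.1 : ℝ) (p.1 + 1) ×ˢ Set.Icc (p.2 : ℝ) (p.2 + 1)

theorem mem_closedSquare {p : ℤ × ℤ} {x : ℝ × ℝ} :
    x ∈ closedSquare p ↔ ((p.1 : ℝ) ≤ x.1 ∧ x.1 ≤ p.1 + 1) ∧ (p.2 : ℝ) ≤ x.2 ∧ x.2 ≤ p.2 + 1 :=
  Iff.rfl

theorem convex_closedSquare (p : ℤ × ℤ) : Convex ℝ (closedSquare p) :=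
  (convex_Icc _ _).prod (convex_Icc _ _)

theorem mem_carrier {S : Set (ℤ × ℤ)} {x : ℝ × ℝ} :
    x ∈ carrier S ↔ ∃ p ∈ S, x ∈ closedSquare p := by
  simp only [carrier, closedSquare, Set.mem_iUnion, exists_prop]

theorem closedSquare_subset_carrier {S : Set (ℤ × ℤ)} {p : ℤ × ℤ} (hp : p ∈ S) :
    closedSquare p ⊆ carrier S := fun _ hx => mem_carrier.2 ⟨p, hp, hx⟩

/-- A lattice point as a point of the plane. -/
def latticePoint (v : ℤ × ℤ) : ℝ × ℝ := (v.1, v.2)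

theorem mem_ball_prod {x y : ℝ × ℝ} {r : ℝ} :
    y ∈ Metric.ball x r ↔ (x.1 - r < y.1 ∧ y.1 < x.1 + r) ∧ x.2 - r < y.2 ∧ y.2 < x.2 + r := by
  rw [Metric.mem_ball, Prod.dist_eq, max_lt_iff, Real.dist_eq, Real.dist_eq, abs_lt, abs_lt]
  constructor <;> rintro ⟨⟨h1, h2⟩, h3, h4⟩ <;> refine ⟨⟨?_, ?_⟩, ?_, ?_⟩ <;> linarith

theorem latticePoint_mem_closedSquare {p v : ℤ × ℤ} :
    latticePoint v ∈ closedSquare p ↔ v ∈ squareCorners p := by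
  rw [mem_closedSquare, mem_squareCorners]
  simp only [latticePoint]
  norm_cast

/-- In the sup metric of `ℝ × ℝ` the unit ball around a lattice point is the interior of the 2 × 2
block of squares around it. These balls serve as open stars of the vertices. -/
theorem mem_squareCorners_of_mem_ball {p v : ℤ × ℤ} {x : ℝ × ℝ} (hx : x ∈ closedSquare p)
    (hv : x ∈ Metric.ball (latticePoint v) 1) : v ∈ squareCorners p := by
  rw [mem_closedSquare] at hx
  rw [mem_ball_prod] at hv
  simp only [latticePoint] at hv
  obtain ⟨⟨a1, a2⟩, a3, a4⟩ := hx
  obtain ⟨⟨b1, b2⟩, b3, b4⟩ := hv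
  have h1 : (v.1 : ℝ) < p.1 + 2 := by linarith
  have h2 : (p.1 : ℝ) < v.1 + 1 := by linarith
  have h3 : (v.2 : ℝ) < p.2 + 2 := by linarith
  have h4 : (p.2 : ℝ) < v.2 + 1 := by linarith
  norm_cast at h1 h2 h3 h4
  rw [mem_squareCorners]
  lia

/-- A ball around `x` which meets only those squares of `S` that contain `x` intersects the carrier
in a star-shaped set. -/
theorem starConvex_ball_inter_carrier {S : Set (ℤ × ℤ)} {x : ℝ × ℝ} {r : ℝ}
    (h : ∀ p ∈ S, ∀ y ∈ Metric.ball x r, y ∈ closedSquare p → x ∈ closedSquare p) :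
    StarConvex ℝ x (Metric.ball x r ∩ carrier S) := by
  rw [starConvex_iff_segment_subset]
  rintro y ⟨hy, hyS⟩
  obtain ⟨p, hp, hyp⟩ := mem_carrier.1 hyS
  have hr : 0 < r := Metric.pos_of_mem_ball hy
  exact Set.subset_inter ((convex_ball x r).segment_subset (Metric.mem_ball_self hr) hy)
    (((convex_closedSquare p).segment_subset (h p hp y hy hyp) hyp).trans
      (closedSquare_subset_carrier hp))

theorem exists_pos_forall_int_lt_add (x : ℝ) :
    ∃ δ > 0, ∀ n : ℤ, (n < x + δ → (n : ℝ) ≤ x) ∧ (x - δ < n → x ≤ n) := by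
  -- The distances to the next integers strictly above and strictly below `x`.
  refine ⟨min (⌊x⌋ + 1 - x) (x - (⌈x⌉ - 1)), ?_, fun n => ⟨fun h => ?_, fun h => ?_⟩⟩
  · have := Int.lt_floor_add_one x
    have := Int.ceil_lt_add_one x
    exact lt_min (by linarith) (by linarith)
  · have h1 : (n : ℝ) < ⌊x⌋ + 1 := by linarith [min_le_left (⌊x⌋ + 1 - x) (x - (⌈x⌉ - 1))]
    norm_cast at h1
    exact Int.le_floor.1 (by lia)
  · have h1 : (⌈x⌉ : ℝ) - 1 < n := by linarith [min_le_right (⌊x⌋ + 1 - x) (x - (⌈x⌉ - 1))]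
    have h2 : (⌈x⌉ : ℝ) < n + 1 := by linarith
    norm_cast at h2
    exact Int.ceil_le.1 (by lia)

theorem exists_ball_closedSquare (x : ℝ × ℝ) :
    ∃ δ > 0, ∀ p : ℤ × ℤ, ∀ y ∈ Metric.ball x δ, y ∈ closedSquare p → x ∈ closedSquare p := by
  obtain ⟨δ₁, h₁, H₁⟩ := exists_pos_forall_int_lt_add x.1
  obtain ⟨δ₂, h₂, H₂⟩ := exists_pos_forall_int_lt_add x.2
  refine ⟨min δ₁ δ₂, lt_min h₁ h₂, fun p y hy hyp => ?_⟩
  rw [mem_ball_prod] at hy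
  rw [mem_closedSquare] at hyp ⊢
  have e1 := min_le_left δ₁ δ₂
  have e2 := min_le_right δ₁ δ₂
  refine ⟨⟨(H₁ p.1).1 (by linarith), ?_⟩, (H₂ p.2).1 (by linarith), ?_⟩
  · have := (H₁ (p.1 + 1)).2 (by push_cast; linarith)
    exact_mod_cast this
  · have := (H₂ (p.2 + 1)).2 (by push_cast; linarith)
    exact_mod_cast this

/-- Small balls meet only squares containing their center, hence meet the carrier in star-shaped
sets. The radius is independent of `S`, so `S` may be infinite. -/
instance locallyPathConnectedSpace_carrier (S : Set (ℤ × ℤ)) :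
    LocallyPathConnectedSpace (carrier S) := by
  choose δ hδ H using exists_ball_closedSquare
  refine LocallyPathConnectedSpace.of_bases (p := fun x r => 0 < r ∧ r ≤ δ x.1)
    (s := fun x r => Metric.ball x r) (fun x => ?_) (fun x r hr => ?_)
  · refine Metric.nhds_basis_ball.to_hasBasis (fun r hr => ?_) (fun r hr => ⟨r, hr.1, subset_rfl⟩)
    exact ⟨min r (δ x.1), ⟨lt_min hr (hδ _), min_le_right _ _⟩,
      Metric.ball_subset_ball (min_le_left _ _)⟩
  · rw [Topology.IsInducing.subtypeVal.isPathConnected_iff]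
    have himg : Subtype.val '' Metric.ball x r = Metric.ball x.1 r ∩ carrier S := by
      rw [Set.inter_comm, ← Subtype.image_preimage_coe]
      rfl
    rw [himg]
    exact (starConvex_ball_inter_carrier fun p _ y hy hyp =>
      H x.1 p y (Metric.ball_subset_ball hr.2 hy) hyp).isPathConnected
        ⟨Metric.mem_ball_self hr.1, x.2⟩

theorem exists_common_corner {p q : ℤ × ℤ} {x : ℝ × ℝ} (hp : x ∈ closedSquare p)
    (hq : x ∈ closedSquare q) : ∃ v, v ∈ squareCorners p ∧ v ∈ squareCorners q := by
  rw [mem_closedSquare] at hp hq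
  obtain ⟨⟨a1, a2⟩, a3, a4⟩ := hp
  obtain ⟨⟨b1, b2⟩, b3, b4⟩ := hq
  have h1 : (p.1 : ℝ) ≤ q.1 + 1 := by linarith
  have h2 : (q.1 : ℝ) ≤ p.1 + 1 := by linarith
  have h3 : (p.2 : ℝ) ≤ q.2 + 1 := by linarith
  have h4 : (q.2 : ℝ) ≤ p.2 + 1 := by linarith
  norm_cast at h1 h2 h3 h4
  refine ⟨(max p.1 q.1, max p.2 q.2), ?_, ?_⟩ <;> rw [mem_squareCorners] <;>
    simp only [le_max_iff, max_le_iff] <;> lia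

/-- A function on the vertices that is constant on each square of a subcomplex with connected
carrier is constant. -/
theorem eq_of_eq_on_squares {S : Set (ℤ × ℤ)} (hS : IsPreconnected (carrier S)) {M : Type*}
    (h : ℤ × ℤ → M)
    (hh : ∀ p ∈ S, ∀ v ∈ squareCorners p, ∀ w ∈ squareCorners p, h v = h w)
    {v w : ℤ × ℤ} (hv : v ∈ vertexSet S) (hw : w ∈ vertexSet S) : h v = h w := by
  have key : ∀ p ∈ S, ∀ q ∈ S, ∀ x, x ∈ closedSquare p → x ∈ closedSquare q → h p = h q := by
    intro p hp q hq x hxp hxq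
    obtain ⟨u, hu, hu'⟩ := exists_common_corner hxp hxq
    rw [hh p hp p (by simp [mem_squareCorners]) u hu, hh q hq q (by simp [mem_squareCorners]) u hu']
  -- Evaluating `h` on an arbitrarily chosen square through `x` is locally constant: the square
  -- chosen for a nearby point also contains `x`, and two squares through `x` share a corner.
  choose! sq hsq hmem using fun x (hx : x ∈ carrier S) => mem_carrier.1 hx
  have hloc : IsLocallyConstant fun x : carrier S => h (sq x) := by
    rw [IsLocallyConstant.iff_eventually_eq]
    intro x
    obtain ⟨δ, hδ, H⟩ := exists_ball_closedSquare x.1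
    filter_upwards [Metric.ball_mem_nhds x hδ] with y hy
    exact key _ (hsq y y.2) _ (hsq x x.2) x (H _ y hy (hmem y y.2)) (hmem x x.2)
  have : PreconnectedSpace (carrier S) := Subtype.preconnectedSpace hS
  obtain ⟨p, hp, hvp⟩ := hv
  obtain ⟨q, hq, hwq⟩ := hw
  have aux : ∀ p ∈ S, ∀ u ∈ squareCorners p, ∃ x : carrier S, h u = h (sq x) := by
    intro p hp u hu
    have hx := latticePoint_mem_closedSquare.2 hu
    refine ⟨⟨latticePoint u, closedSquare_subset_carrier hp hx⟩, ?_⟩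
    rw [hh p hp u hu p (by simp [mem_squareCorners])]
    exact key p hp _ (hsq _ (closedSquare_subset_carrier hp hx)) _ hx
      (hmem _ (closedSquare_subset_carrier hp hx))
  obtain ⟨x, hx⟩ := aux p hp v hvp
  obtain ⟨y, hy⟩ := aux q hq w hwq
  rw [hx, hy]
  exact hloc.apply_eq_of_preconnectedSpace x y

/-! ### Gluing functions given on the single squares -/

/-- Functions on the corners of the single squares whose differences agree on common edges glue, up
to additive constants, to a function on the vertices of a simply connected subcomplex. -/
theorem exists_potential {S : Set (ℤ × ℤ)} (hS : IsSimplyConnected (carrier S)) {M : Type*}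
    [AddCommGroup M] (φ : ℤ × ℤ → ℤ × ℤ → M)
    (hφ : ∀ p ∈ S, ∀ q ∈ S, ∀ v w, v ∈ squareCorners p → w ∈ squareCorners p →
      v ∈ squareCorners q → w ∈ squareCorners q → φ p w - φ p v = φ q w - φ q v) :
    ∃ F : ℤ × ℤ → M, ∀ p ∈ S, ∀ v ∈ squareCorners p, ∀ w ∈ squareCorners p,
      F w - F v = φ p w - φ p v := by
  classical
  have := hS.simplyConnectedSpace
  -- By `hφ` the difference does not depend on the chosen square. All vertices whose stars contain a
  -- point `x` are corners of any square of `S` through `x`, which gives the cocycle identity.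
  let c : ℤ × ℤ → ℤ × ℤ → M := fun v w =>
    if h : ∃ p ∈ S, v ∈ squareCorners p ∧ w ∈ squareCorners p then φ h.choose w - φ h.choose v
    else 0
  have hcval : ∀ p ∈ S, ∀ v ∈ squareCorners p, ∀ w ∈ squareCorners p,
      c v w = φ p w - φ p v := by
    intro p hp v hv w hw
    have h : ∃ p ∈ S, v ∈ squareCorners p ∧ w ∈ squareCorners p := ⟨p, hp, hv, hw⟩
    simp only [c, dif_pos h]
    exact hφ _ h.choose_spec.1 p hp v w h.choose_spec.2.1 h.choose_spec.2.2 hv hw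
  let U : ℤ × ℤ → Set (carrier S) := fun v => Subtype.val ⁻¹' Metric.ball (latticePoint v) 1
  have hstar : ∀ v, ∀ p ∈ S, ∀ y ∈ Metric.ball (latticePoint v) 1, y ∈ closedSquare p →
      latticePoint v ∈ closedSquare p := fun v p _ y hy hyp =>
    latticePoint_mem_closedSquare.2 (mem_squareCorners_of_mem_ball hyp hy)
  obtain ⟨F, hF⟩ := exists_coboundary_of_simplyConnected U
    (fun v => Metric.isOpen_ball.preimage continuous_subtype_val)
    (fun v => by
      rw [← Topology.IsInducing.subtypeVal.isPreconnected_image, Subtype.image_preimage_coe,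
        Set.inter_comm]
      rcases (Metric.ball (latticePoint v) 1 ∩ carrier S).eq_empty_or_nonempty with he | ⟨y, hy, hyS⟩
      · rw [he]
        exact isPreconnected_empty
      · obtain ⟨p, hp, hyp⟩ := mem_carrier.1 hyS
        exact ((starConvex_ball_inter_carrier (hstar v)).isPathConnected
          ⟨Metric.mem_ball_self one_pos,
            closedSquare_subset_carrier hp (hstar v p hp y hy hyp)⟩).isConnected.isPreconnected)
    (fun x => by
      refine ⟨(round x.1.1, round x.1.2), ?_⟩
      have h1 := abs_le.1 (abs_sub_round x.1.1)
      have h2 := abs_le.1 (abs_sub_round x.1.2)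
      change x.1 ∈ Metric.ball _ _
      rw [mem_ball_prod]
      simp only [latticePoint]
      refine ⟨⟨?_, ?_⟩, ?_, ?_⟩ <;> linarith)
    c
    (fun u v w x hu hv hw => by
      obtain ⟨p, hp, hxp⟩ := mem_carrier.1 x.2
      have hu' := mem_squareCorners_of_mem_ball hxp hu
      have hv' := mem_squareCorners_of_mem_ball hxp hv
      have hw' := mem_squareCorners_of_mem_ball hxp hw
      rw [hcval p hp u hu' v hv', hcval p hp v hv' w hw', hcval p hp u hu' w hw']
      abel)
  refine ⟨F, fun p hp v hv w hw => ?_⟩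
  rw [← hcval p hp v hv w hw]
  -- The midpoint of the square lies in the stars of all four corners, so these stars overlap.
  have hmid : ((p.1 + 1 / 2, p.2 + 1 / 2) : ℝ × ℝ) ∈ closedSquare p := by
    rw [mem_closedSquare]
    refine ⟨⟨?_, ?_⟩, ?_, ?_⟩ <;> simp only <;> linarith
  have hmem : ∀ u ∈ squareCorners p,
      ((p.1 + 1 / 2, p.2 + 1 / 2) : ℝ × ℝ) ∈ Metric.ball (latticePoint u) 1 := by
    intro u hu
    rw [mem_squareCorners] at hu
    obtain ⟨⟨a1, a2⟩, a3, a4⟩ := hu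
    rify at a1 a2 a3 a4
    rw [mem_ball_prod]
    simp only [latticePoint]
    refine ⟨⟨?_, ?_⟩, ?_, ?_⟩ <;> linarith
  exact hF v w ⟨⟨_, closedSquare_subset_carrier hp hmid⟩, hmem v hv, hmem w hw⟩

/-! ### Orthogonal rings and the frame of a square -/

theorem OuterInnerOrthogonal.norm_sq {A B : OrientedRing} (h : OuterInnerOrthogonal A B) :
    ‖B.center - A.center‖ ^ 2 = A.outer ^ 2 + B.inner ^ 2 := by
  obtain ⟨x, ⟨hA, hB⟩, hx⟩ := h
  rw [OrientedRing.outerCircle, mem_sphere_iff_norm] at hA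
  rw [OrientedRing.innerCircle, mem_sphere_iff_norm] at hB
  have : B.center - A.center = (x - A.center) - (x - B.center) := by ring
  rw [this, norm_sub_sq_real, hx, hA, hB, sq_abs]
  ring

theorem OrientedRing.outer_pos (A : OrientedRing) : 0 < A.outer :=
  (abs_nonneg _).trans_lt A.abs_inner_lt_outer

theorem outerInnerOrthogonal_of_norm_sq {A B : OrientedRing}
    (h : ‖B.center - A.center‖ ^ 2 = A.outer ^ 2 + B.inner ^ 2) : OuterInnerOrthogonal A B := by
  set d := B.center - A.center with hd
  set R := A.outer with hR
  set r := B.inner with hr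
  have hRpos : 0 < R := A.outer_pos
  have hL : 0 < R ^ 2 + r ^ 2 := by positivity
  have hLc : (R : ℂ) ^ 2 + (r : ℂ) ^ 2 ≠ 0 := by exact_mod_cast hL.ne'
  -- Solves d = (R - i r) k: the right triangle over the segment of centers has legs R k and -i r k,
  -- so the common point is `A.center + R * k`.
  set k : ℂ := d * (R + Complex.I * r) / (R ^ 2 + r ^ 2) with hk
  have hknorm : ‖k‖ = 1 := by
    have h1 : ‖k‖ ^ 2 = 1 := by
      have h2 : ‖(R + Complex.I * r : ℂ)‖ ^ 2 = R ^ 2 + r ^ 2 := by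
        rw [Complex.sq_norm, Complex.normSq_apply]; simp; ring
      have h3 : ‖((R : ℂ) ^ 2 + (r : ℂ) ^ 2)‖ = R ^ 2 + r ^ 2 := by
        rw [← Complex.ofReal_pow, ← Complex.ofReal_pow, ← Complex.ofReal_add,
          Complex.norm_real, Real.norm_of_nonneg hL.le]
      rw [hk, norm_div, norm_mul, div_pow, mul_pow, h, h2, h3]
      field_simp
    exact (sq_eq_sq₀ (norm_nonneg _) zero_le_one).1 (by rw [h1, one_pow])
  have hxA : A.center + R * k - A.center = R * k := by ring
  have hxB : A.center + R * k - B.center = Complex.I * r * k := by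
    have : B.center = A.center + d := by rw [hd]; ring
    rw [this, hk]
    field_simp
    ring_nf
    simp only [Complex.I_sq]
    ring
  refine ⟨A.center + R * k, ⟨?_, ?_⟩, ?_⟩
  · rw [OrientedRing.outerCircle, mem_sphere_iff_norm, hxA, norm_mul, hknorm, Complex.norm_real,
      Real.norm_of_nonneg hRpos.le, mul_one]
  · rw [OrientedRing.innerCircle, mem_sphere_iff_norm, hxB, norm_mul, norm_mul, hknorm,
      Complex.norm_real, Complex.norm_I, Real.norm_eq_abs, one_mul, mul_one]
  · rw [hxA, hxB, Complex.inner]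
    simp
    ring

/-! Points of the plane in the frame with origin `t` and unit vector `w`. -/

theorem mem_sphere_frame {t w : ℂ} (hw : ‖w‖ = 1) (x c : ℂ) {r : ℝ} (hr : 0 ≤ r) :
    t + w * x ∈ Metric.sphere (t + w * c) r ↔ (x.re - c.re) ^ 2 + (x.im - c.im) ^ 2 = r ^ 2 := by
  rw [mem_sphere_iff_norm, ← sq_eq_sq₀ (norm_nonneg _) hr]
  have : t + w * x - (t + w * c) = w * (x - c) := by ring
  rw [this, norm_mul, hw, one_mul, Complex.sq_norm, Complex.normSq_apply, Complex.sub_re,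
    Complex.sub_im]
  simp only [pow_two]

theorem origin_mem_sphere_frame {t w : ℂ} (hw : ‖w‖ = 1) (c : ℂ) {r : ℝ} (hr : 0 ≤ r) :
    t ∈ Metric.sphere (t + w * c) r ↔ c.re ^ 2 + c.im ^ 2 = r ^ 2 := by
  simpa using mem_sphere_frame (t := t) hw 0 c hr

theorem isCCW_frame {t w : ℂ} (hw : ‖w‖ = 1) (x y z : ℂ) :
    IsCCW (t + w * x) (t + w * y) (t + w * z) ↔
      0 < (y.re - x.re) * (z.im - x.im) - (y.im - x.im) * (z.re - x.re) := by
  have h1 : t + w * y - (t + w * x) = w * (y - x) := by ring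
  have h2 : t + w * z - (t + w * x) = w * (z - x) := by ring
  have h3 : (starRingEnd ℂ) w * w = 1 := by
    rw [mul_comm, Complex.mul_conj, Complex.normSq_eq_norm_sq, hw]; simp
  have h4 : (starRingEnd ℂ) (w * (y - x)) * (w * (z - x))
      = ((starRingEnd ℂ) w * w) * ((starRingEnd ℂ) (y - x) * (z - x)) := by
    rw [map_mul]; ring
  rw [IsCCW, h1, h2, h4, h3, one_mul, Complex.mul_im, Complex.conj_re, Complex.conj_im]
  simp only [Complex.sub_re, Complex.sub_im]
  constructor <;> intro h <;> linarith

theorem exists_frame_coord {w : ℂ} (hw : ‖w‖ = 1) (t x : ℂ) : ∃ x', x = t + w * x' := by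
  have : w ≠ 0 := norm_ne_zero_iff.1 (by rw [hw]; exact one_ne_zero)
  exact ⟨(x - t) / w, by field_simp; ring⟩

/-- In the frame whose origin is the touching point of the outer circles of `B` and `D` and whose
unit vector points to the center of `B`, a ring `A` with the stated center satisfies the orientation
rule. -/
theorem cornerOriented_of_frame {A B D : OrientedRing} {t w : ℂ} (hw : ‖w‖ = 1)
    (hA : A.center = t + w * ⟨0, -A.inner⟩) (hB : B.center = t + w * ⟨B.outer, 0⟩)
    (hD : D.center = t + w * ⟨-D.outer, 0⟩) : CornerOriented A B D t := by
  have hRB := B.outer_pos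
  have hRD := D.outer_pos
  set r := A.inner with hr
  set R := B.outer
  set R' := D.outer
  have ht : t = t + w * (0 : ℂ) := by ring
  -- The second intersection point is the mirror image of `t` in the line through the centers of `A`
  -- and `B`; `hy` does the same for `D`.
  have hx : r ≠ 0 → t + w * ⟨2 * R * r ^ 2 / (R ^ 2 + r ^ 2), -2 * R ^ 2 * r / (R ^ 2 + r ^ 2)⟩ ∈
      (A.innerCircle ∩ B.outerCircle) \ D.outerCircle := by
    intro hr0
    have h2 : R ^ 2 + r ^ 2 ≠ 0 := by positivity
    refine ⟨⟨?_, ?_⟩, ?_⟩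
    · rw [OrientedRing.innerCircle, hA, mem_sphere_frame hw _ _ (abs_nonneg _), sq_abs]
      simp only
      field_simp
      ring
    · rw [OrientedRing.outerCircle, hB, mem_sphere_frame hw _ _ hRB.le]
      simp only
      field_simp
      ring
    · rw [OrientedRing.outerCircle, hD, mem_sphere_frame hw _ _ hRD.le]
      simp only
      have h3 : 0 < 2 * R * r ^ 2 / (R ^ 2 + r ^ 2) := by positivity
      apply ne_of_gt
      nlinarith [sq_nonneg (-2 * R ^ 2 * r / (R ^ 2 + r ^ 2)), mul_pos h3 hRD]
  have hy : r ≠ 0 →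
      t + w * ⟨-(2 * R' * r ^ 2) / (R' ^ 2 + r ^ 2), -2 * R' ^ 2 * r / (R' ^ 2 + r ^ 2)⟩ ∈
      (A.innerCircle ∩ D.outerCircle) \ B.outerCircle := by
    intro hr0
    have h2 : R' ^ 2 + r ^ 2 ≠ 0 := by positivity
    refine ⟨⟨?_, ?_⟩, ?_⟩
    · rw [OrientedRing.innerCircle, hA, mem_sphere_frame hw _ _ (abs_nonneg _), sq_abs]
      simp only
      field_simp
      ring
    · rw [OrientedRing.outerCircle, hD, mem_sphere_frame hw _ _ hRD.le]
      simp only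
      field_simp
      ring
    · rw [OrientedRing.outerCircle, hB, mem_sphere_frame hw _ _ hRB.le]
      simp only
      have h3 : 0 < 2 * R' * r ^ 2 / (R' ^ 2 + r ^ 2) := by positivity
      apply ne_of_gt
      rw [neg_div]
      nlinarith [sq_nonneg (-2 * R' ^ 2 * r / (R' ^ 2 + r ^ 2)), mul_pos h3 hRB]
  constructor
  · intro h
    refine ⟨_, hx h.ne', _, hy h.ne', ?_⟩
    nth_rewrite 2 [ht]
    rw [isCCW_frame hw]
    simp only [Complex.zero_re, Complex.zero_im]
    have : 0 < 4 * R * R' * (R + R') * r ^ 3 / ((R ^ 2 + r ^ 2) * (R' ^ 2 + r ^ 2)) := by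
      positivity
    convert! this using 1
    field_simp
    ring
  · intro h
    refine ⟨_, hx h.ne, _, hy h.ne, ?_⟩
    nth_rewrite 2 [ht]
    rw [isCCW_frame hw]
    simp only [Complex.zero_re, Complex.zero_im]
    have : 0 < 4 * R * R' * (R + R') * (-r) ^ 3 / ((R ^ 2 + r ^ 2) * (R' ^ 2 + r ^ 2)) := by
      have := neg_pos.2 h
      positivity
    convert! this using 1
    field_simp
    ring

/-- Converse of `cornerOriented_of_frame`: orthogonality and the orientation rule determine the
center of `A`. -/
theorem CornerOriented.center_eq {A B D : OrientedRing} {t w : ℂ} (hw : ‖w‖ = 1)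
    (h : CornerOriented A B D t) (hB : B.center = t + w * ⟨B.outer, 0⟩)
    (hD : D.center = t + w * ⟨-D.outer, 0⟩) (ht : t ∈ A.innerCircle)
    (hBA : OuterInnerOrthogonal B A) : A.center = t + w * ⟨0, -A.inner⟩ := by
  have hRB := B.outer_pos
  have hRD := D.outer_pos
  obtain ⟨a, ha⟩ := exists_frame_coord hw t A.center
  have ht0 : t = t + w * (0 : ℂ) := by ring
  have h1 : a.re ^ 2 + a.im ^ 2 = A.inner ^ 2 := by
    rwa [OrientedRing.innerCircle, ha, origin_mem_sphere_frame hw _ (abs_nonneg _), sq_abs] at ht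
  have h2 : a.re = 0 := by
    have h3 := hBA.norm_sq
    have h4 : A.center - B.center = w * (a - ⟨B.outer, 0⟩) := by rw [ha, hB]; ring
    rw [h4, norm_mul, hw, one_mul, Complex.sq_norm, Complex.normSq_apply] at h3
    simp only [Complex.sub_re, Complex.sub_im] at h3
    have : B.outer * a.re = 0 := by linarith
    exact (mul_eq_zero.1 this).resolve_left hRB.ne'
  rw [h2] at h1
  have h3 : a.im = -A.inner ∨ a.im = A.inner := by
    rcases sq_eq_sq_iff_eq_or_eq_neg.1 (show a.im ^ 2 = A.inner ^ 2 by linarith) with h | h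
    · exact Or.inr h
    · exact Or.inl h
  -- Both circles pass through the origin of the frame, so their equations have no constant term,
  -- and subtracting them leaves the line of the common chord.
  have hcirc : ∀ x, x ∈ A.innerCircle → x ∈ B.outerCircle → ∃ x' : ℂ, x = t + w * x' ∧
      x'.re ^ 2 + x'.im ^ 2 = 2 * x'.im * a.im ∧ x'.re * B.outer = x'.im * a.im := by
    intro x hxA hxB
    obtain ⟨x', rfl⟩ := exists_frame_coord hw t x
    rw [OrientedRing.innerCircle, ha, mem_sphere_frame hw _ _ (abs_nonneg _), sq_abs] at hxA
    rw [OrientedRing.outerCircle, hB, mem_sphere_frame hw _ _ hRB.le] at hxB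
    rw [h2] at hxA
    simp only at hxB
    exact ⟨x', rfl, by nlinarith, by nlinarith⟩
  have hcirc' : ∀ y, y ∈ A.innerCircle → y ∈ D.outerCircle → ∃ y' : ℂ, y = t + w * y' ∧
      y'.re ^ 2 + y'.im ^ 2 = 2 * y'.im * a.im ∧ y'.re * D.outer = -(y'.im * a.im) := by
    intro x hxA hxD
    obtain ⟨x', rfl⟩ := exists_frame_coord hw t x
    rw [OrientedRing.innerCircle, ha, mem_sphere_frame hw _ _ (abs_nonneg _), sq_abs] at hxA
    rw [OrientedRing.outerCircle, hD, mem_sphere_frame hw _ _ hRD.le] at hxD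
    rw [h2] at hxA
    simp only at hxD
    exact ⟨x', rfl, by nlinarith, by nlinarith⟩
  suffices hfin : a.im = -A.inner by
    rw [ha]
    congr 2
    exact Complex.ext h2 hfin
  rcases h3 with h3 | h3
  · exact h3
  -- The sign of the orientation determinant is opposite to that of `a.im`, which rules out the
  -- remaining choice `a.im = A.inner` unless the radius is zero.
  have hsign : ∀ x y : ℂ, x.re ^ 2 + x.im ^ 2 = 2 * x.im * a.im → x.re * B.outer = x.im * a.im →
      y.re ^ 2 + y.im ^ 2 = 2 * y.im * a.im → y.re * D.outer = -(y.im * a.im) →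
      (x.im * y.re - x.re * y.im) * a.im ≤ 0 := by
    intro x y hx1 hx2 hy1 hy2
    have e1 : x.re = x.im * a.im / B.outer := by field_simp; linarith
    have e2 : y.re = -(y.im * a.im) / D.outer := by field_simp; linarith
    have e3 : 0 ≤ x.im * a.im := by nlinarith [sq_nonneg x.re, sq_nonneg x.im]
    have e4 : 0 ≤ y.im * a.im := by nlinarith [sq_nonneg y.re, sq_nonneg y.im]
    have e5 : (x.im * y.re - x.re * y.im) * a.im
        = -((x.im * a.im) * (y.im * a.im) * (1 / B.outer + 1 / D.outer)) := by
      rw [e1, e2]; field_simp; ring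
    rw [e5]
    have : 0 ≤ (x.im * a.im) * (y.im * a.im) * (1 / B.outer + 1 / D.outer) := by positivity
    linarith
  rcases lt_trichotomy A.inner 0 with hneg | hzero | hpos
  · obtain ⟨x, ⟨⟨hxA, hxB⟩, -⟩, y, ⟨⟨hyA, hyD⟩, -⟩, hccw⟩ := h.2 hneg
    obtain ⟨x', rfl, hx1, hx2⟩ := hcirc x hxA hxB
    obtain ⟨y', rfl, hy1, hy2⟩ := hcirc' y hyA hyD
    nth_rewrite 2 [ht0] at hccw
    rw [isCCW_frame hw] at hccw
    simp only [Complex.zero_re, Complex.zero_im] at hccw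
    nlinarith [hsign x' y' hx1 hx2 hy1 hy2]
  · rw [h3, hzero, neg_zero]
  · obtain ⟨x, ⟨⟨hxA, hxB⟩, -⟩, y, ⟨⟨hyA, hyD⟩, -⟩, hccw⟩ := h.1 hpos
    obtain ⟨x', rfl, hx1, hx2⟩ := hcirc x hxA hxB
    obtain ⟨y', rfl, hy1, hy2⟩ := hcirc' y hyA hyD
    nth_rewrite 2 [ht0] at hccw
    rw [isCCW_frame hw] at hccw
    simp only [Complex.zero_re, Complex.zero_im] at hccw
    nlinarith [hsign x' y' hx1 hx2 hy1 hy2]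

/-- The centers of the rings of a square in the frame with origin `t` and unit vector `w`. -/
structure IsSquareFrame (A B C D : OrientedRing) (t w : ℂ) : Prop where
  norm_eq_one : ‖w‖ = 1
  center₁ : A.center = t + w * ⟨0, -A.inner⟩
  center₂ : B.center = t + w * ⟨B.outer, 0⟩
  center₃ : C.center = t + w * ⟨0, C.inner⟩
  center₄ : D.center = t + w * ⟨-D.outer, 0⟩

theorem mul_mk_eq_neg_mul (w : ℂ) (a b : ℝ) : w * ⟨a, b⟩ = -w * ⟨-a, -b⟩ := by
  have : (⟨-a, -b⟩ : ℂ) = -⟨a, b⟩ := by apply Complex.ext <;> simp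
  rw [this]
  ring

theorem IsSquareFrame.squareCondition {A B C D : OrientedRing} {t w : ℂ}
    (h : IsSquareFrame A B C D t w) : SquareCondition A B C D := by
  obtain ⟨hw, hA, hB, hC, hD⟩ := h
  have hRB := B.outer_pos
  have hRD := D.outer_pos
  have hw0 : w ≠ 0 := norm_ne_zero_iff.1 (by rw [hw]; exact one_ne_zero)
  refine ⟨t, ?_, ?_, ?_, ?_, ⟨?_, ?_, ?_⟩, cornerOriented_of_frame hw hA hB hD,
    cornerOriented_of_frame (w := -w) (by rwa [norm_neg]) ?_ ?_ ?_⟩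
  · rw [OrientedRing.innerCircle, hA, origin_mem_sphere_frame hw _ (abs_nonneg _)]
    simp
  · rw [OrientedRing.innerCircle, hC, origin_mem_sphere_frame hw _ (abs_nonneg _)]
    simp
  · rw [OrientedRing.outerCircle, hB, origin_mem_sphere_frame hw _ hRB.le]
    simp
  · rw [OrientedRing.outerCircle, hD, origin_mem_sphere_frame hw _ hRD.le]
    simp
  · refine ⟨B.outer / (B.outer + D.outer), ⟨by positivity, ?_⟩, ?_⟩
    · rw [div_le_one (by positivity)]
      linarith
    · rw [AffineMap.lineMap_apply, hB, hD, vsub_eq_sub, vadd_eq_add]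
      have e1 : ((⟨B.outer, 0⟩ : ℂ)) = (B.outer : ℂ) := rfl
      have e2 : ((⟨-D.outer, 0⟩ : ℂ)) = -(D.outer : ℂ) := by apply Complex.ext <;> simp
      have e3 : (B.outer : ℂ) + D.outer ≠ 0 := by
        exact_mod_cast (add_pos hRB hRD).ne'
      rw [e1, e2, Complex.real_smul]
      push_cast
      field_simp
      ring
  · intro h
    rw [hB] at h
    have : w * (⟨B.outer, 0⟩ : ℂ) = 0 := by linear_combination -h
    have := congrArg Complex.re ((mul_eq_zero.1 this).resolve_left hw0)
    simp at this
    linarith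
  · intro h
    rw [hD] at h
    have : w * (⟨-D.outer, 0⟩ : ℂ) = 0 := by linear_combination -h
    have := congrArg Complex.re ((mul_eq_zero.1 this).resolve_left hw0)
    simp at this
    linarith
  · rw [hC, mul_mk_eq_neg_mul, neg_zero]
  · rw [hD, mul_mk_eq_neg_mul, neg_zero, neg_neg]
  · rw [hB, mul_mk_eq_neg_mul, neg_zero]

/-- Tangency puts the centers of `B` and `D` on one line through `t`; `CornerOriented.center_eq`
then locates `A`, and also `C` after a half turn of the frame, which exchanges `B` and `D`. -/
theorem SquareCondition.exists_isSquareFrame {A B C D : OrientedRing}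
    (h : SquareCondition A B C D) (hBA : OuterInnerOrthogonal B A)
    (hDC : OuterInnerOrthogonal D C) : ∃ t w, IsSquareFrame A B C D t w := by
  obtain ⟨t, htA, htC, htB, htD, hs, hoA, hoC⟩ := h
  have hRB := B.outer_pos
  have hRD := D.outer_pos
  rw [OrientedRing.outerCircle, mem_sphere_iff_norm, norm_sub_rev] at htB htD
  have hRBc : (B.outer : ℂ) ≠ 0 := by exact_mod_cast hRB.ne'
  obtain ⟨w, hw, hB⟩ : ∃ w : ℂ, ‖w‖ = 1 ∧ B.center = t + w * ⟨B.outer, 0⟩ := by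
    refine ⟨(B.center - t) / B.outer, ?_, ?_⟩
    · rw [norm_div, htB, Complex.norm_real, Real.norm_of_nonneg hRB.le, div_self hRB.ne']
    · change _ = t + (B.center - t) / B.outer * (B.outer : ℂ)
      field_simp
      ring
  have hD : D.center = t + w * ⟨-D.outer, 0⟩ := by
    obtain ⟨⟨s, ⟨hs0, hs1⟩, hst⟩, hne, -⟩ := hs
    rw [AffineMap.lineMap_apply, vsub_eq_sub, vadd_eq_add, Complex.real_smul] at hst
    have hs0' : s ≠ 0 := by
      rintro rfl
      apply hne
      rw [← hst]
      simp
    have hsc : (s : ℂ) ≠ 0 := by exact_mod_cast hs0'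
    have hspos : 0 < s := lt_of_le_of_ne hs0 (Ne.symm hs0')
    have e1 : D.center - t = -(((1 - s) / s : ℝ) : ℂ) * (B.center - t) := by
      push_cast
      field_simp
      linear_combination hst
    have e2 : D.outer = (1 - s) / s * B.outer := by
      rw [← htD, ← htB, e1, norm_mul, norm_neg, Complex.norm_real, Real.norm_of_nonneg]
      exact div_nonneg (by linarith) hs0
    have e3 : ((⟨-D.outer, 0⟩ : ℂ)) = -(D.outer : ℂ) := by apply Complex.ext <;> simp
    have e4 : B.center - t = w * (B.outer : ℂ) := by rw [hB]; change t + w * (B.outer : ℂ) - t = _; ring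
    rw [e3, e2]
    rw [e4] at e1
    push_cast at e1 ⊢
    linear_combination e1
  refine ⟨t, w, hw, hoA.center_eq hw hB hD htA hBA, hB, ?_, hD⟩
  have := hoC.center_eq (w := -w) (by rwa [norm_neg])
    (by rw [hD, mul_mk_eq_neg_mul, neg_zero, neg_neg])
    (by rw [hB, mul_mk_eq_neg_mul, neg_zero]) htC hDC
  rw [this, mul_mk_eq_neg_mul, neg_neg, neg_neg, neg_zero]

/-! ### The rotation between adjacent frames -/

/-- The angle between the frames of two adjacent squares, as a function of the difference of the
`ρ`-radii at the ends of the common side (the Gudermannian function). -/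
noncomputable def frameAngle (x : ℝ) : ℝ := 2 * Real.arctan (Real.exp x) - Real.pi / 2

theorem frameAngle_neg (x : ℝ) : frameAngle (-x) = -frameAngle x := by
  rw [frameAngle, frameAngle, Real.exp_neg, Real.arctan_inv_of_pos (Real.exp_pos x)]
  ring

theorem abs_frameAngle_lt (x : ℝ) : |frameAngle x| < Real.pi / 2 := by
  have h1 := Real.arctan_pos.2 (Real.exp_pos x)
  have h2 := Real.arctan_lt_pi_div_two (Real.exp x)
  rw [frameAngle, abs_lt]
  constructor <;> linarith

theorem cos_frameAngle_mul_cosh (x : ℝ) : Real.cos (frameAngle x) * Real.cosh x = 1 := by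
  have h := Real.exp_pos x
  rw [frameAngle, Real.cos_sub_pi_div_two, Real.sin_two_mul, Real.sin_arctan, Real.cos_arctan,
    Real.cosh_eq, Real.exp_neg]
  have h2 : Real.sqrt (1 + Real.exp x ^ 2) ^ 2 = 1 + Real.exp x ^ 2 := Real.sq_sqrt (by positivity)
  have h3 : Real.sqrt (1 + Real.exp x ^ 2) ≠ 0 := by positivity
  field_simp
  linarith

theorem sin_frameAngle_mul_cosh (x : ℝ) : Real.sin (frameAngle x) * Real.cosh x = Real.sinh x := by
  have h := Real.exp_pos x
  rw [frameAngle, Real.sin_sub_pi_div_two, Real.cos_two_mul, Real.cos_sq_arctan,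
    Real.cosh_eq, Real.sinh_eq, Real.exp_neg]
  field_simp
  ring

theorem exp_frameAngle_mul_cosh (x : ℝ) :
    Complex.exp (frameAngle x * Complex.I) * Complex.cosh x = 1 + Complex.I * Complex.sinh x := by
  rw [Complex.exp_mul_I]
  have h1 := cos_frameAngle_mul_cosh x
  have h2 := sin_frameAngle_mul_cosh x
  apply_fun ((↑) : ℝ → ℂ) at h1 h2
  push_cast at h1 h2
  linear_combination h1 + Complex.I * h2

/-- Both complex numbers have the same modulus because cosh² - sinh² = 1; the angle between them
depends only on `x - y` by the addition formulas. -/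
theorem exp_frameAngle_sub_mul (x y : ℝ) :
    Complex.exp (frameAngle (x - y) * Complex.I) *
      (Complex.cosh y - Complex.I * Complex.sinh x)
      = Complex.cosh x - Complex.I * Complex.sinh y := by
  have h := exp_frameAngle_mul_cosh (x - y)
  have hne : Complex.cosh ((x - y : ℝ) : ℂ) ≠ 0 := by
    rw [← Complex.ofReal_cosh]
    exact_mod_cast (Real.cosh_pos _).ne'
  refine mul_right_cancel₀ hne ?_
  push_cast at h ⊢
  have hx := Complex.cosh_sq (x : ℂ)
  have hy := Complex.cosh_sq (y : ℂ)
  rw [mul_right_comm, h, Complex.cosh_sub, Complex.sinh_sub]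
  linear_combination Complex.I * Complex.sinh x * hy - Complex.cosh y * hx +
    (Complex.sinh x * Complex.cosh x * Complex.sinh y - Complex.sinh x ^ 2 * Complex.cosh y) *
      Complex.I_sq

theorem cosh_sub_I_mul_sinh_ne_zero (x y : ℝ) :
    Complex.cosh x - Complex.I * Complex.sinh y ≠ 0 := by
  rw [← Complex.ofReal_cosh, ← Complex.ofReal_sinh]
  intro h
  have := congrArg Complex.re h
  simp at this
  exact (Real.cosh_pos x).ne' this

theorem eq_exp_frameAngle_mul {w w' : ℂ} {x y : ℝ}
    (h : (Complex.cosh x - Complex.I * Complex.sinh y) * w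
      = (Complex.cosh y - Complex.I * Complex.sinh x) * w') :
    w' = Complex.exp (frameAngle (x - y) * Complex.I) * w := by
  rw [← exp_frameAngle_sub_mul] at h
  refine mul_left_cancel₀ (cosh_sub_I_mul_sinh_ne_zero y x) ?_
  rw [← h]
  ring

/-! ### Necessity of the closure equation, ρ-radii, uniqueness -/

/-- The centers of the rings at the corners of the square `p` are given by the frame `t, w`. -/
abbrev IsFrameAt (P : ℤ × ℤ → OrientedRing) (p : ℤ × ℤ) (t w : ℂ) : Prop :=
  IsSquareFrame (P (p.1, p.2)) (P (p.1 + 1, p.2)) (P (p.1 + 1, p.2 + 1)) (P (p.1, p.2 + 1)) t w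

section

variable {S : Set (ℤ × ℤ)} {P : ℤ × ℤ → OrientedRing} {ℓ : ℝ} {ρ : ℤ × ℤ → ℝ} {p : ℤ × ℤ}

theorem IsOrthogonalRingPattern.exists_isFrameAt (h : IsOrthogonalRingPattern S P) (hp : p ∈ S) :
    ∃ t w, IsFrameAt P p t w := by
  refine (h.square p.1 p.2 hp).exists_isSquareFrame (h.orthogonal _ _ ⟨?_, p, hp, ?_, ?_⟩).1
    (h.orthogonal _ _ ⟨?_, p, hp, ?_, ?_⟩).1
  · simp [latticeGraph]
  · simp [mem_squareCorners]
  · simp [mem_squareCorners]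
  · simp [latticeGraph]
  · simp [mem_squareCorners]
  · simp [mem_squareCorners]

/-- The vector between the centers at the ends of the common side, written in both frames, gives w
(R_B - i r_C) = w' (R_C - i r_B). -/
theorem IsFrameAt.right (hℓ : 0 < ℓ) (hP : HasRhoRadii S P ℓ ρ) (hp : p ∈ S) {t w t' w' : ℂ}
    (h : IsFrameAt P p t w) (h' : IsFrameAt P (p.1 + 1, p.2) t' w') :
    w' = Complex.exp (frameAngle (ρ (p.1 + 1, p.2) - ρ (p.1 + 1, p.2 + 1)) * Complex.I) * w := by
  have hB := hP _ (mem_vertexSet hp (v := (p.1 + 1, p.2)) (by simp [mem_squareCorners]))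
  have hC := hP _ (mem_vertexSet hp (v := (p.1 + 1, p.2 + 1)) (by simp [mem_squareCorners]))
  have e1 := h.center₂.symm.trans h'.center₁
  have e2 := h.center₃.symm.trans h'.center₄
  rw [hB.1, hB.2] at e1
  rw [hC.1, hC.2] at e2
  simp only [Complex.mk_eq_add_mul_I] at e1 e2
  push_cast at e1 e2
  apply eq_exp_frameAngle_mul
  have hℓc : (ℓ : ℂ) ≠ 0 := by exact_mod_cast hℓ.ne'
  refine mul_left_cancel₀ hℓc ?_
  linear_combination e1 - e2

theorem IsFrameAt.up (hℓ : 0 < ℓ) (hP : HasRhoRadii S P ℓ ρ) (hp : p ∈ S) {t w t' w' : ℂ}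
    (h : IsFrameAt P p t w) (h' : IsFrameAt P (p.1, p.2 + 1) t' w') :
    w' = Complex.exp (frameAngle (ρ (p.1 + 1, p.2 + 1) - ρ (p.1, p.2 + 1)) * Complex.I) * w := by
  have hD := hP _ (mem_vertexSet hp (v := (p.1, p.2 + 1)) (by simp [mem_squareCorners]))
  have hC := hP _ (mem_vertexSet hp (v := (p.1 + 1, p.2 + 1)) (by simp [mem_squareCorners]))
  have e1 := h.center₄.symm.trans h'.center₁
  have e2 := h.center₃.symm.trans h'.center₂
  rw [hD.1, hD.2] at e1
  rw [hC.1, hC.2] at e2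
  simp only [Complex.mk_eq_add_mul_I] at e1 e2
  push_cast at e1 e2
  -- Across a horizontal side the relation is w (R_D + i r_C) = w' (R_C + i r_D); negating ρ flips
  -- the signs of the inner radii and reduces it to the same identity.
  have := eq_exp_frameAngle_mul (x := -ρ (p.1, p.2 + 1)) (y := -ρ (p.1 + 1, p.2 + 1))
    (w := w) (w' := w') (by
      have hℓc : (ℓ : ℂ) ≠ 0 := by exact_mod_cast hℓ.ne'
      refine mul_left_cancel₀ hℓc ?_
      push_cast
      rw [Complex.cosh_neg, Complex.cosh_neg, Complex.sinh_neg, Complex.sinh_neg]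
      linear_combination e2 - e1)
  rwa [neg_sub_neg] at this

theorem sum_latticeNeighbors {M : Type*} [AddCommMonoid M] (v : ℤ × ℤ) (f : ℤ × ℤ → M) :
    ∑ w ∈ latticeNeighbors v, f w =
      f (v.1 + 1, v.2) + (f (v.1, v.2 + 1) + (f (v.1 - 1, v.2) + f (v.1, v.2 - 1))) := by
  rw [latticeNeighbors, Finset.sum_insert, Finset.sum_insert, Finset.sum_insert,
    Finset.sum_singleton] <;> simp [Prod.ext_iff] <;> lia

/-- The four shifts by π/2 in `frameAngle` absorb the 2π. -/
theorem closureEquation_iff : ClosureEquation S ρ ↔ ∀ v, IsInteriorVertex S v →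
    frameAngle (ρ v - ρ (v.1 + 1, v.2)) + frameAngle (ρ v - ρ (v.1, v.2 + 1)) +
      frameAngle (ρ v - ρ (v.1 - 1, v.2)) + frameAngle (ρ v - ρ (v.1, v.2 - 1)) = 0 := by
  refine forall₂_congr fun v _ => ?_
  rw [sum_latticeNeighbors]
  simp only [frameAngle]
  constructor <;> intro h <;> linarith

theorem IsOrthogonalRingPattern.closureEquation (h : IsOrthogonalRingPattern S P) (hℓ : 0 < ℓ)
    (hP : HasRhoRadii S P ℓ ρ) : ClosureEquation S ρ := by
  rw [closureEquation_iff]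
  rintro ⟨m, n⟩ ⟨h₁, h₂, h₃, h₄⟩
  simp only at h₁ h₂ h₃ h₄ ⊢
  obtain ⟨t₁, w₁, f₁⟩ := h.exists_isFrameAt h₁
  obtain ⟨t₂, w₂, f₂⟩ := h.exists_isFrameAt h₂
  obtain ⟨t₃, w₃, f₃⟩ := h.exists_isFrameAt h₃
  obtain ⟨t₄, w₄, f₄⟩ := h.exists_isFrameAt h₄
  have e₁ := IsFrameAt.right hℓ hP h₂ (t' := t₁) (w' := w₁) f₂ (by simpa using f₁)
  have e₂ := IsFrameAt.up hℓ hP h₃ (t' := t₂) (w' := w₂) f₃ (by simpa using f₂)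
  have e₃ := IsFrameAt.right hℓ hP h₃ (t' := t₄) (w' := w₄) f₃ (by simpa using f₄)
  have e₄ := IsFrameAt.up hℓ hP h₄ (t' := t₁) (w' := w₁) f₄ (by simpa using f₁)
  simp only [sub_add_cancel] at e₁ e₂ e₃ e₄
  rw [← neg_sub, frameAngle_neg] at e₃ e₄
  have hw₃ : w₃ ≠ 0 := norm_ne_zero_iff.1 (by rw [f₃.norm_eq_one]; exact one_ne_zero)
  -- The two ways around the vertex from the lower left to the upper right square give the same
  -- frame direction.
  rw [e₂, ← mul_assoc, ← Complex.exp_add] at e₁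
  rw [e₃, ← mul_assoc, ← Complex.exp_add, e₁] at e₄
  have e₅ := mul_right_cancel₀ hw₃ e₄
  rw [Complex.exp_eq_exp_iff_exists_int] at e₅
  obtain ⟨k, hk⟩ := e₅
  set a := frameAngle (ρ (m, n) - ρ (m + 1, n))
  set b := frameAngle (ρ (m, n) - ρ (m, n + 1))
  set c := frameAngle (ρ (m, n) - ρ (m - 1, n))
  set d := frameAngle (ρ (m, n) - ρ (m, n - 1))
  have hk' : a + b + c + d = k * (2 * Real.pi) := by
    have := congrArg Complex.im hk
    simp at this
    linarith
  have ha := abs_lt.1 (abs_frameAngle_lt (ρ (m, n) - ρ (m + 1, n)))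
  have hb := abs_lt.1 (abs_frameAngle_lt (ρ (m, n) - ρ (m, n + 1)))
  have hc := abs_lt.1 (abs_frameAngle_lt (ρ (m, n) - ρ (m - 1, n)))
  have hd := abs_lt.1 (abs_frameAngle_lt (ρ (m, n) - ρ (m, n - 1)))
  -- Four angles of absolute value below π/2 have a sum strictly between -2π and 2π.
  have hk0 : k = 0 := by
    have h1 : (k : ℝ) < 1 := by
      by_contra! hcon
      nlinarith [Real.pi_pos]
    have h2 : (-1 : ℝ) < k := by
      by_contra! hcon
      nlinarith [Real.pi_pos]
    norm_cast at h1
    have h2' : -1 < k := by exact_mod_cast h2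
    lia
  rw [hk', hk0]
  simp

/-- Orthogonality of both pairs of circles computes the squared distance of the centers as R_i² +
r_j² and as R_j² + r_i². Hence R² - r² is the same at neighbors, and it is constant since the
carrier is connected, even through pinched vertices. -/
theorem IsOrthogonalRingPattern.exists_hasRhoRadii (hS : IsConnected (carrier S))
    (h : IsOrthogonalRingPattern S P) : ∃ (ℓ : ℝ) (ρ : ℤ × ℤ → ℝ), 0 < ℓ ∧ HasRhoRadii S P ℓ ρ := by
  have hedge : ∀ v w, IsEdge S v w →
      (P v).outer ^ 2 - (P v).inner ^ 2 = (P w).outer ^ 2 - (P w).inner ^ 2 := fun v w hvw => by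
    have h1 := (h.orthogonal v w hvw).1.norm_sq
    have h2 := (h.orthogonal v w hvw).2.norm_sq
    rw [norm_sub_rev] at h2
    linarith
  have hsq : ∀ p ∈ S, ∀ v ∈ squareCorners p,
      (P v).outer ^ 2 - (P v).inner ^ 2 = (P p).outer ^ 2 - (P p).inner ^ 2 := by
    intro p hp v hv
    have hB := hedge (p.1 + 1, p.2) p
      ⟨by simp [latticeGraph], p, hp, by simp [mem_squareCorners], by simp [mem_squareCorners]⟩
    have hD := hedge (p.1, p.2 + 1) p
      ⟨by simp [latticeGraph], p, hp, by simp [mem_squareCorners], by simp [mem_squareCorners]⟩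
    have hC := hedge (p.1 + 1, p.2 + 1) (p.1 + 1, p.2)
      ⟨by simp [latticeGraph], p, hp, by simp [mem_squareCorners], by simp [mem_squareCorners]⟩
    rcases hv with rfl | rfl | rfl | rfl
    · rfl
    · exact hB
    · exact hC.trans hB
    · exact hD
  obtain ⟨x, hx⟩ := hS.nonempty
  obtain ⟨p, hp, -⟩ := mem_carrier.1 hx
  have hpos : ∀ v, 0 < (P v).outer ^ 2 - (P v).inner ^ 2 := fun v => by
    have := sq_lt_sq' (by linarith [(P v).outer_pos, abs_nonneg (P v).inner])
      (P v).abs_inner_lt_outer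
    rw [sq_abs] at this
    linarith
  obtain ⟨ℓ, hℓ, hℓsq⟩ : ∃ ℓ > 0, ℓ ^ 2 = (P p).outer ^ 2 - (P p).inner ^ 2 :=
    ⟨_, Real.sqrt_pos.2 (hpos p), Real.sq_sqrt (hpos p).le⟩
  refine ⟨ℓ, fun v => Real.arsinh ((P v).inner / ℓ), hℓ, fun v hv => ?_⟩
  have hv' := eq_of_eq_on_squares hS.isPreconnected
    (fun v => (P v).outer ^ 2 - (P v).inner ^ 2)
    (fun p hp v hv w hw => (hsq p hp v hv).trans (hsq p hp w hw).symm) hv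
    (mem_vertexSet hp (v := p) (by simp [mem_squareCorners]))
  rw [Real.sinh_arsinh, Real.cosh_arsinh]
  refine ⟨?_, by field_simp⟩
  rw [← sq_eq_sq₀ (P v).outer_pos.le (by positivity), mul_pow, Real.sq_sqrt (by positivity)]
  field_simp
  linarith

theorem exists_isometry_of_hasRhoRadii (hS : (latticeGraph.induce S).Connected) (hℓ : 0 < ℓ)
    {Q : ℤ × ℤ → OrientedRing} (hP : IsOrthogonalRingPattern S P) (hPρ : HasRhoRadii S P ℓ ρ)
    (hQ : IsOrthogonalRingPattern S Q) (hQρ : HasRhoRadii S Q ℓ ρ) :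
    ∃ a b : ℂ, ‖a‖ = 1 ∧ ∀ v ∈ vertexSet S, (Q v).center = a * (P v).center + b := by
  choose! t w hf using fun p (hp : p ∈ S) => hP.exists_isFrameAt hp
  choose! t' w' hf' using fun p (hp : p ∈ S) => hQ.exists_isFrameAt hp
  have hw0 : ∀ p ∈ S, w p ≠ 0 := fun p hp =>
    norm_ne_zero_iff.1 (by rw [(hf p hp).norm_eq_one]; exact one_ne_zero)
  have hcenter : ∀ p ∈ S, ∀ v ∈ squareCorners p,
      (Q v).center = w' p / w p * (P v).center + (t' p - w' p / w p * t p) := by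
    intro p hp v hv
    have hw := hw0 p hp
    have hr := hPρ v (mem_vertexSet hp hv)
    have hr' := hQρ v (mem_vertexSet hp hv)
    rw [← hr'.1, ← hr'.2] at hr
    have e := hf p hp
    have e' := hf' p hp
    have key : ∀ z : ℂ, t' p + w' p * z
        = w' p / w p * (t p + w p * z) + (t' p - w' p / w p * t p) := fun z => by
      field_simp
      ring
    rcases hv with rfl | rfl | rfl | rfl
    · have e1 := e.center₁
      have e1' := e'.center₁
      rw [← hr.2] at e1'
      exact e1'.trans (by rw [key, ← e1])
    · have e1 := e.center₂
      have e1' := e'.center₂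
      rw [← hr.1] at e1'
      exact e1'.trans (by rw [key, ← e1])
    · have e1 := e.center₃
      have e1' := e'.center₃
      rw [← hr.2] at e1'
      exact e1'.trans (by rw [key, ← e1])
    · have e1 := e.center₄
      have e1' := e'.center₄
      rw [← hr.1] at e1'
      exact e1'.trans (by rw [key, ← e1])
  have hstep : ∀ p ∈ S, ∀ q ∈ S, q = (p.1 + 1, p.2) ∨ q = (p.1, p.2 + 1) →
      w' p / w p = w' q / w q := by
    intro p hp q hq hpq
    -- The rotation to the next square depends only on ρ, so it is common to both patterns and
    -- cancels in the quotient.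
    obtain ⟨α, h1, h2⟩ : ∃ α : ℂ, w q = Complex.exp α * w p ∧ w' q = Complex.exp α * w' p := by
      rcases hpq with rfl | rfl
      · exact ⟨_, (hf p hp).right hℓ hPρ hp (hf _ hq), (hf' p hp).right hℓ hQρ hp (hf' _ hq)⟩
      · exact ⟨_, (hf p hp).up hℓ hPρ hp (hf _ hq), (hf' p hp).up hℓ hQρ hp (hf' _ hq)⟩
    rw [h1, h2, mul_div_mul_left _ _ (Complex.exp_ne_zero α)]
  have hadj : ∀ p ∈ S, ∀ q ∈ S, latticeGraph.Adj p q →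
      w' p / w p = w' q / w q ∧ ∃ v, v ∈ squareCorners p ∧ v ∈ squareCorners q := by
    intro p hp q hq hpq
    have hcases : (q = (p.1 + 1, p.2) ∨ q = (p.1, p.2 + 1)) ∨
        (p = (q.1 + 1, q.2) ∨ p = (q.1, q.2 + 1)) := by
      simp only [Prod.ext_iff]
      rcases hpq with ⟨h1, h2⟩ | ⟨h1, h2⟩ <;> rcases abs_eq zero_le_one |>.1 h2 with h | h <;> lia
    rcases hcases with hc | hc
    · refine ⟨hstep p hp q hq hc, q, ?_, by simp [mem_squareCorners]⟩
      rcases hc with rfl | rfl <;> simp [mem_squareCorners]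
    · refine ⟨(hstep q hq p hp hc).symm, p, by simp [mem_squareCorners], ?_⟩
      rcases hc with rfl | rfl <;> simp [mem_squareCorners]
  -- Adjacent squares have the same rotation part, and the center at a common corner then forces
  -- equal translation parts. At a pinched vertex the rotation could change, hence the chain of
  -- sides.
  have hconst : ∀ p q : S, (latticeGraph.induce S).Reachable p q →
      w' p / w p = w' q / w q ∧
        t' p - w' p / w p * t p = t' q - w' q / w q * t q := by
    rintro p q ⟨walk⟩
    induction walk with
    | nil => exact ⟨rfl, rfl⟩
    | @cons u v x huv _ ih =>
      obtain ⟨h1, c, hc, hc'⟩ := hadj u u.2 v v.2 huv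
      have h2 := hcenter u u.2 c hc
      rw [hcenter v v.2 c hc', h1] at h2
      exact ⟨h1.trans ih.1, by rw [h1]; exact (add_left_cancel h2).symm.trans ih.2⟩
  obtain ⟨p₀⟩ := hS.nonempty
  refine ⟨w' p₀ / w p₀, t' p₀ - w' p₀ / w p₀ * t p₀, ?_, ?_⟩
  · rw [norm_div, (hf p₀ p₀.2).norm_eq_one, (hf' p₀ p₀.2).norm_eq_one, div_one]
  · rintro v ⟨p, hp, hv⟩
    have := hconst p₀ ⟨p, hp⟩ (hS.preconnected _ _)
    rw [this.2, this.1]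
    exact hcenter p hp v hv

end

/-! ### Construction of a pattern from the ρ-radii -/

section

variable {S : Set (ℤ × ℤ)} {ρ : ℤ × ℤ → ℝ}

/-- Prescribed differences between cyclically adjacent values, of which those with an endpoint
missing are not required. -/
theorem exists_cyclic_potential (a₁ a₂ a₃ a₄ : Prop) (x y z u : ℝ)
    (h : a₁ → a₂ → a₃ → a₄ → x + y + z + u = 0) :
    ∃ b₁ b₂ b₃ b₄ : ℝ, (a₁ → a₂ → b₁ - b₂ = x) ∧ (a₂ → a₃ → b₂ - b₃ = y) ∧
      (a₃ → a₄ → b₃ - b₄ = z) ∧ (a₄ → a₁ → b₄ - b₁ = u) := by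
  by_cases h₁ : a₁
  · by_cases h₂ : a₂
    · by_cases h₃ : a₃
      -- With all four entries present the last difference closes up by `h`; if one is missing, the
      -- cycle is cut there and the values are summed along the remaining path.
      · refine ⟨0, -x, -x - y, -x - y - z, ?_, ?_, ?_, fun h₄ _ => ?_⟩
        · intros; ring
        · intros; ring
        · intros; ring
        · linarith [h h₁ h₂ h₃ h₄]
      · refine ⟨0, -x, 0, u, ?_, ?_, ?_, ?_⟩ <;> intros <;> first | contradiction | ring
    · refine ⟨0, 0, u + z, u, ?_, ?_, ?_, ?_⟩ <;> intros <;> first | contradiction | ring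
  · refine ⟨0, y + z, z, 0, ?_, ?_, ?_, ?_⟩ <;> intros <;> first | contradiction | ring

/-- Around every single vertex the frames of the squares can be chosen consistently. -/
theorem ClosureEquation.exists_angles_at (h : ClosureEquation S ρ) (v : ℤ × ℤ) :
    ∃ Θ : ℤ × ℤ → ℝ,
      (∀ p ∈ S, (p.1 + 1, p.2) ∈ S → v ∈ squareCorners p → v ∈ squareCorners (p.1 + 1, p.2) →
        Θ (p.1 + 1, p.2) - Θ p = frameAngle (ρ (p.1 + 1, p.2) - ρ (p.1 + 1, p.2 + 1))) ∧
      ∀ p ∈ S, (p.1, p.2 + 1) ∈ S → v ∈ squareCorners p → v ∈ squareCorners (p.1, p.2 + 1) →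
        Θ (p.1, p.2 + 1) - Θ p = frameAngle (ρ (p.1 + 1, p.2 + 1) - ρ (p.1, p.2 + 1)) := by
  obtain ⟨m, n⟩ := v
  obtain ⟨b₁, b₂, b₃, b₄, h₁, h₂, h₃, h₄⟩ := exists_cyclic_potential
    ((m, n) ∈ S) ((m - 1, n) ∈ S) ((m - 1, n - 1) ∈ S) ((m, n - 1) ∈ S)
    (frameAngle (ρ (m, n) - ρ (m, n + 1))) (frameAngle (ρ (m, n) - ρ (m - 1, n)))
    (frameAngle (ρ (m, n) - ρ (m, n - 1))) (frameAngle (ρ (m, n) - ρ (m + 1, n)))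
    (fun h₁ h₂ h₃ h₄ => by
      have := closureEquation_iff.1 h (m, n) ⟨h₁, h₂, h₃, h₄⟩
      simp only at this
      linarith)
  -- The last branch is meant for the square `(m, n - 1)`; its value at squares away from `v` plays
  -- no role.
  refine ⟨fun q => if q = (m, n) then b₁ else if q = (m - 1, n) then b₂ else
    if q = (m - 1, n - 1) then b₃ else b₄, ?_, ?_⟩
  · rintro ⟨i, j⟩ hp hq hv hv'
    rw [mem_squareCorners] at hv hv'
    simp only at hp hq hv hv' ⊢
    obtain rfl : i = m - 1 := by lia
    rcases (by lia : j = n ∨ j = n - 1) with rfl | rfl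
    · simpa using h₁ (by simpa using hq) hp
    · have := h₃ hp (by simpa using hq)
      rw [← neg_sub (ρ _), frameAngle_neg]
      simp [(sub_one_lt _).ne']
      linarith
  · rintro ⟨i, j⟩ hp hq hv hv'
    rw [mem_squareCorners] at hv hv'
    simp only at hp hq hv hv' ⊢
    obtain rfl : j = n - 1 := by lia
    rcases (by lia : i = m ∨ i = m - 1) with rfl | rfl
    · have := h₄ hp (by simpa using hq)
      rw [← neg_sub (ρ _), frameAngle_neg]
      simp [(sub_one_lt _).ne']
      linarith
    · simpa using h₂ (by simpa using hq) hp

/-- It suffices to check the compatibility of functions on the corners of the squares for a square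
and its right and upper neighbor. -/
theorem compatible_of_adjacent {M : Type*} [AddCommGroup M] (φ : ℤ × ℤ → ℤ × ℤ → M)
    (h : ∀ p ∈ S, ∀ q ∈ S, q = (p.1 + 1, p.2) ∨ q = (p.1, p.2 + 1) →
      ∀ v w, v ∈ squareCorners p → w ∈ squareCorners p → v ∈ squareCorners q →
        w ∈ squareCorners q → φ p w - φ p v = φ q w - φ q v) :
    ∀ p ∈ S, ∀ q ∈ S, ∀ v w, v ∈ squareCorners p → w ∈ squareCorners p →
      v ∈ squareCorners q → w ∈ squareCorners q → φ p w - φ p v = φ q w - φ q v := by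
  intro p hp q hq v w hv hw hv' hw'
  by_cases hpq : p = q
  · rw [hpq]
  by_cases hvw : v = w
  · rw [hvw, sub_self, sub_self]
  -- Distinct squares with two distinct common corners share a side.
  have hcases : (q = (p.1 + 1, p.2) ∨ q = (p.1, p.2 + 1)) ∨
      (p = (q.1 + 1, q.2) ∨ p = (q.1, q.2 + 1)) := by
    rw [mem_squareCorners] at hv hw hv' hw'
    rw [Prod.ext_iff] at hpq hvw
    simp only [Prod.ext_iff]
    lia
  rcases hcases with hc | hc
  · exact h p hp q hq hc v w hv hw hv' hw'
  · exact (h q hq p hp hc v w hv' hw' hv hw).symm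

theorem ClosureEquation.exists_angles (hS : IsSimplyConnected (carrier S))
    (h : ClosureEquation S ρ) :
    ∃ θ : ℤ × ℤ → ℝ,
      (∀ p ∈ S, (p.1 + 1, p.2) ∈ S →
        θ (p.1 + 1, p.2) = θ p + frameAngle (ρ (p.1 + 1, p.2) - ρ (p.1 + 1, p.2 + 1))) ∧
      ∀ p ∈ S, (p.1, p.2 + 1) ∈ S →
        θ (p.1, p.2 + 1) = θ p + frameAngle (ρ (p.1 + 1, p.2 + 1) - ρ (p.1, p.2 + 1)) := by
  -- Around each vertex there is a local solution. On squares sharing a side, the solutions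
  -- belonging to its two ends have the same increment, so their difference is the same on both
  -- squares and integrates to `F`.
  choose Θ hright hup using h.exists_angles_at
  obtain ⟨F, hF⟩ := exists_potential hS (fun p v => Θ v p) (compatible_of_adjacent _ (by
    rintro p hp q hq (rfl | rfl) v w hv hw hv' hw'
    · linarith [hright v p hp hq hv hv', hright w p hp hq hw hw']
    · linarith [hup v p hp hq hv hv', hup w p hp hq hw hw']))
  -- `Θ v p - F v` is the same for all corners `v` of `p`, so evaluation at the lower left corner is
  -- only a convention.
  refine ⟨fun p => Θ p p - F p, fun p hp hq => ?_, fun p hp hq => ?_⟩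
  · have hv : (p.1 + 1, p.2) ∈ squareCorners p := by simp [mem_squareCorners]
    have h1 := hF p hp p (by simp [mem_squareCorners]) _ hv
    have h2 := hright (p.1 + 1, p.2) p hp hq hv (by simp [mem_squareCorners])
    simp only at h1 h2 ⊢
    linarith
  · have hv : (p.1, p.2 + 1) ∈ squareCorners p := by simp [mem_squareCorners]
    have h1 := hF p hp p (by simp [mem_squareCorners]) _ hv
    have h2 := hup (p.1, p.2 + 1) p hp hq hv (by simp [mem_squareCorners])
    simp only at h1 h2 ⊢
    linarith

/-- The center of the ring at the corner `v` of the square `p`, in the frame of this square. -/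
noncomputable def frameCenter (ℓ : ℝ) (ρ : ℤ × ℤ → ℝ) (p v : ℤ × ℤ) : ℂ :=
  if v = (p.1, p.2) then ⟨0, -(ℓ * Real.sinh (ρ v))⟩
  else if v = (p.1 + 1, p.2) then ⟨ℓ * Real.cosh (ρ v), 0⟩
  else if v = (p.1 + 1, p.2 + 1) then ⟨0, ℓ * Real.sinh (ρ v)⟩
  else ⟨-(ℓ * Real.cosh (ρ v)), 0⟩

variable (ℓ : ℝ) (p : ℤ × ℤ)

theorem frameCenter₁ :
    frameCenter ℓ ρ p (p.1, p.2) = ⟨0, -(ℓ * Real.sinh (ρ (p.1, p.2)))⟩ := by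
  simp [frameCenter]

theorem frameCenter₂ :
    frameCenter ℓ ρ p (p.1 + 1, p.2) = ⟨ℓ * Real.cosh (ρ (p.1 + 1, p.2)), 0⟩ := by
  simp [frameCenter, Prod.ext_iff]

theorem frameCenter₃ :
    frameCenter ℓ ρ p (p.1 + 1, p.2 + 1) = ⟨0, ℓ * Real.sinh (ρ (p.1 + 1, p.2 + 1))⟩ := by
  simp [frameCenter, Prod.ext_iff]

theorem frameCenter₄ :
    frameCenter ℓ ρ p (p.1, p.2 + 1) = ⟨-(ℓ * Real.cosh (ρ (p.1, p.2 + 1))), 0⟩ := by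
  simp [frameCenter, Prod.ext_iff]

theorem frameCenter_right {w w' : ℂ}
    (h : w' = Complex.exp (frameAngle (ρ (p.1 + 1, p.2) - ρ (p.1 + 1, p.2 + 1)) * Complex.I) * w) :
    w * (frameCenter ℓ ρ p (p.1 + 1, p.2 + 1) - frameCenter ℓ ρ p (p.1 + 1, p.2)) =
      w' * (frameCenter ℓ ρ (p.1 + 1, p.2) (p.1 + 1, p.2 + 1) -
        frameCenter ℓ ρ (p.1 + 1, p.2) (p.1 + 1, p.2)) := by
  have h1 := frameCenter₁ (ρ := ρ) ℓ (p.1 + 1, p.2)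
  have h4 := frameCenter₄ (ρ := ρ) ℓ (p.1 + 1, p.2)
  simp only at h1 h4
  rw [frameCenter₂, frameCenter₃, h1, h4, h]
  have := exp_frameAngle_sub_mul (ρ (p.1 + 1, p.2)) (ρ (p.1 + 1, p.2 + 1))
  simp only [Complex.mk_eq_add_mul_I]
  push_cast at this ⊢
  linear_combination ℓ * w * this

theorem frameCenter_up {w w' : ℂ}
    (h : w' = Complex.exp (frameAngle (ρ (p.1 + 1, p.2 + 1) - ρ (p.1, p.2 + 1)) * Complex.I) * w) :
    w * (frameCenter ℓ ρ p (p.1 + 1, p.2 + 1) - frameCenter ℓ ρ p (p.1, p.2 + 1)) =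
      w' * (frameCenter ℓ ρ (p.1, p.2 + 1) (p.1 + 1, p.2 + 1) -
        frameCenter ℓ ρ (p.1, p.2 + 1) (p.1, p.2 + 1)) := by
  have h1 := frameCenter₁ (ρ := ρ) ℓ (p.1, p.2 + 1)
  have h2 := frameCenter₂ (ρ := ρ) ℓ (p.1, p.2 + 1)
  simp only at h1 h2
  rw [frameCenter₃, frameCenter₄, h1, h2, h]
  have := exp_frameAngle_sub_mul (-ρ (p.1, p.2 + 1)) (-ρ (p.1 + 1, p.2 + 1))
  rw [neg_sub_neg] at this
  push_cast at this
  simp only [Complex.cosh_neg, Complex.sinh_neg] at this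
  simp only [Complex.mk_eq_add_mul_I]
  push_cast
  linear_combination (-ℓ) * w * this

theorem abs_mul_sinh_lt {ℓ : ℝ} (hℓ : 0 < ℓ) (x : ℝ) : |ℓ * Real.sinh x| < ℓ * Real.cosh x := by
  rw [abs_mul, abs_of_pos hℓ, Real.abs_sinh, ← Real.cosh_abs]
  exact mul_lt_mul_of_pos_left (Real.sinh_lt_cosh _) hℓ

/-- With a common value of R² - r², one of the two Pythagorean relations implies the other. -/
theorem ringsOrthogonal_of_norm_sq {A B : OrientedRing}
    (h : ‖A.center - B.center‖ ^ 2 = A.outer ^ 2 + B.inner ^ 2)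
    (h' : A.outer ^ 2 - A.inner ^ 2 = B.outer ^ 2 - B.inner ^ 2) : RingsOrthogonal A B := by
  refine ⟨outerInnerOrthogonal_of_norm_sq ?_, outerInnerOrthogonal_of_norm_sq ?_⟩
  · rwa [norm_sub_rev]
  · linarith

theorem ringsOrthogonal_of_frame {A B : OrientedRing} {t w a b : ℂ} (hw : ‖w‖ = 1)
    (hA : A.center = t + w * a) (hB : B.center = t + w * b)
    (h : (a.re - b.re) ^ 2 + (a.im - b.im) ^ 2 = A.outer ^ 2 + B.inner ^ 2)
    (h' : A.outer ^ 2 - A.inner ^ 2 = B.outer ^ 2 - B.inner ^ 2) :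
    RingsOrthogonal A B ∧ RingsOrthogonal B A := by
  have key : RingsOrthogonal A B := by
    refine ringsOrthogonal_of_norm_sq ?_ h'
    have : A.center - B.center = w * (a - b) := by rw [hA, hB]; ring
    rw [this, norm_mul, hw, one_mul, Complex.sq_norm, Complex.normSq_apply, ← h, Complex.sub_re,
      Complex.sub_im]
    ring
  exact ⟨key, key.2, key.1⟩

theorem ClosureEquation.exists_isOrthogonalRingPattern (hS : IsSimplyConnected (carrier S))
    (h : ClosureEquation S ρ) {ℓ : ℝ} (hℓ : 0 < ℓ) :
    ∃ P : ℤ × ℤ → OrientedRing, IsOrthogonalRingPattern S P ∧ HasRhoRadii S P ℓ ρ := by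
  obtain ⟨θ, hright, hup⟩ := h.exists_angles hS
  let w : ℤ × ℤ → ℂ := fun p => Complex.exp (θ p * Complex.I)
  -- The second integration: with these directions, neighboring frames give the same difference of
  -- centers along their common side, so the centers glue to `F`.
  obtain ⟨F, hF⟩ := exists_potential hS (fun p v => w p * frameCenter ℓ ρ p v)
    (compatible_of_adjacent _ (by
      rintro p hp q hq (rfl | rfl) u v hu hv hu' hv'
      · have key := frameCenter_right ℓ p (ρ := ρ) (w := w p) (w' := w (p.1 + 1, p.2)) (by
          simp only [w]
          rw [← Complex.exp_add, hright p hp hq]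
          congr 1
          push_cast
          ring)
        have hcases : ∀ x, x ∈ squareCorners p → x ∈ squareCorners (p.1 + 1, p.2) →
            x = (p.1 + 1, p.2) ∨ x = (p.1 + 1, p.2 + 1) := fun x hx hx' => by
          rw [mem_squareCorners] at hx hx'
          simp only [Prod.ext_iff] at hx' ⊢
          lia
        rcases hcases u hu hu' with rfl | rfl <;> rcases hcases v hv hv' with rfl | rfl
        · ring
        · linear_combination key
        · linear_combination -key
        · ring
      · have key := frameCenter_up ℓ p (ρ := ρ) (w := w p) (w' := w (p.1, p.2 + 1)) (by
          simp only [w]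
          rw [← Complex.exp_add, hup p hp hq]
          congr 1
          push_cast
          ring)
        have hcases : ∀ x, x ∈ squareCorners p → x ∈ squareCorners (p.1, p.2 + 1) →
            x = (p.1, p.2 + 1) ∨ x = (p.1 + 1, p.2 + 1) := fun x hx hx' => by
          rw [mem_squareCorners] at hx hx'
          simp only [Prod.ext_iff] at hx' ⊢
          lia
        rcases hcases u hu hu' with rfl | rfl <;> rcases hcases v hv hv' with rfl | rfl
        · ring
        · linear_combination key
        · linear_combination -key
        · ring))
  let P : ℤ × ℤ → OrientedRing := fun v =>
    ⟨F v, ℓ * Real.sinh (ρ v), ℓ * Real.cosh (ρ v), abs_mul_sinh_lt hℓ _⟩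
  have hframe : ∀ p ∈ S, ∃ t, IsFrameAt P p t (w p) := by
    intro p hp
    have hc : ∀ v ∈ squareCorners p,
        F v = F p - w p * frameCenter ℓ ρ p p + w p * frameCenter ℓ ρ p v := fun v hv => by
      have := hF p hp p (by simp [mem_squareCorners]) v hv
      linear_combination this
    refine ⟨F p - w p * frameCenter ℓ ρ p p, Complex.norm_exp_ofReal_mul_I _, ?_, ?_, ?_, ?_⟩
    · rw [← frameCenter₁]
      exact hc _ (by simp [mem_squareCorners])
    · rw [← frameCenter₂]
      exact hc _ (by simp [mem_squareCorners])
    · rw [← frameCenter₃]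
      exact hc _ (by simp [mem_squareCorners])
    · rw [← frameCenter₄]
      exact hc _ (by simp [mem_squareCorners])
  have hdiff : ∀ u v, (P u).outer ^ 2 - (P u).inner ^ 2 = (P v).outer ^ 2 - (P v).inner ^ 2 := by
    intro u v
    simp only [P, mul_pow, Real.cosh_sq]
    ring
  refine ⟨P, ⟨?_, ?_⟩, fun v _ => ⟨rfl, rfl⟩⟩
  · rintro u v ⟨hadj, p, hp, hu, hv⟩
    obtain ⟨t, f⟩ := hframe p hp
    have h12 := ringsOrthogonal_of_frame f.norm_eq_one f.center₂ f.center₁ (by simp) (hdiff _ _)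
    have h23 := ringsOrthogonal_of_frame f.norm_eq_one f.center₂ f.center₃ (by simp) (hdiff _ _)
    have h34 := ringsOrthogonal_of_frame f.norm_eq_one f.center₄ f.center₃ (by simp) (hdiff _ _)
    have h41 := ringsOrthogonal_of_frame f.norm_eq_one f.center₄ f.center₁ (by simp) (hdiff _ _)
    -- Only the four sides of the square survive; equal or opposite corners contradict `hadj`.
    rcases hu with rfl | rfl | rfl | rfl <;> rcases hv with rfl | rfl | rfl | rfl
    all_goals first
      | exact h12.1 | exact h12.2 | exact h23.1 | exact h23.2
      | exact h34.1 | exact h34.2 | exact h41.1 | exact h41.2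
      | (simp [latticeGraph] at hadj)
  · intro m n hmn
    obtain ⟨t, f⟩ := hframe (m, n) hmn
    exact f.squareCondition

end

theorem theorem1 (S : Set (ℤ × ℤ)) (hS : IsSimplyConnected (carrier S)) :
    (∀ P : ℤ × ℤ → OrientedRing, IsOrthogonalRingPattern S P →
      (∃ (ℓ : ℝ) (ρ : ℤ × ℤ → ℝ), 0 < ℓ ∧ HasRhoRadii S P ℓ ρ) ∧
      ∀ (ℓ : ℝ) (ρ : ℤ × ℤ → ℝ), 0 < ℓ → HasRhoRadii S P ℓ ρ → ClosureEquation S ρ) ∧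
    (∀ ρ : ℤ × ℤ → ℝ, ClosureEquation S ρ → ∀ ℓ : ℝ, 0 < ℓ →
      (∃ P : ℤ × ℤ → OrientedRing, IsOrthogonalRingPattern S P ∧ HasRhoRadii S P ℓ ρ) ∧
      ((latticeGraph.induce S).Connected →
        ∀ P Q : ℤ × ℤ → OrientedRing,
          IsOrthogonalRingPattern S P → HasRhoRadii S P ℓ ρ →
          IsOrthogonalRingPattern S Q → HasRhoRadii S Q ℓ ρ →
          ∃ a b : ℂ, ‖a‖ = 1 ∧ ∀ v ∈ vertexSet S, (Q v).center = a * (P v).center + b)) := by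
  have hconn : IsConnected (carrier S) := hS.isPathConnected.isConnected
  refine ⟨fun P hP => ⟨hP.exists_hasRhoRadii hconn, fun ℓ ρ hℓ hρ => hP.closureEquation hℓ hρ⟩,
    fun ρ hρ ℓ hℓ => ⟨hρ.exists_isOrthogonalRingPattern hS hℓ, fun hsq P Q hP hPρ hQ hQρ =>
      exists_isometry_of_hasRhoRadii hsq hℓ hP hPρ hQ hQρ⟩⟩
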